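/- Let $p\ge 1$ be an integer, $q=2p+1$, and $\vartheta=\frac{p}{2p+1}\cdot 2\pi$. Let a point particle move counterclockwise inside a circle of radius $R>0$, reflecting elastically at the circle, and let $P_0,P_1,P_2,\dots$ be its successive points on the circle ($P_0$ being the starting point), where $P_1$ is obtained from $P_0$ by rotation through the angle $\vartheta$ about the centre. For $0\le n\le 2p+1$ let $f_n$ be the number of regions into which the disc is cut by the first $n$ chords $P_0P_1,\dots,P_{n-1}P_n$ of the trajectory, i.e. the number of connected components of the open disc minus the union of these chords. Then $f_n$ is finite and $$f_n=2-\delta_{n,0}+\sum_{i=1}^{n-1} i-\delta_{2p+1,n}=2-(\delta_{n,0}+\delta_{n,2p+1})+\frac{n(n-1)}{2},\qquad 0\le n\le 2p+1,$$ where $\delta_{i,j}$ is the Kronecker delta. Consequently $f_0=1$, $f_1=2$, $f_{n+1}=f_n+n$ for $1\le n<2p$, $f_{2p+1}=f_{2p}+2p-1$, and $f_{2p+1}=pq+1$. -/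

import Mathlib

noncomputable section

namespace CircularBilliard

/-- `P 0, P 1, P 2, …` are the successive scattering points of a point particle moving
counterclockwise in the circular billiard table of radius `R` centred at the origin of the
plane `ℂ`, where `θ` is the angle at the centre between the first two scattering points.
At each scattering point `P (k + 1)` the collision is elastic: the outgoing direction is the
mirror image of the incoming direction in the tangent line of the circle at `P (k + 1)`,
which is the orthogonal complement of the line spanned by the normal `P (k + 1)`. -/
structure IsTrajectory (R θ : ℝ) (P : ℕ → ℂ) : Prop where
  on_circle : ∀ k, ‖P k‖ = R
  first_angle : P 1 = Complex.exp ((θ : ℂ) * Complex.I) * P 0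
  elastic : ∀ k, ∃ t : ℝ, 0 < t ∧
    P (k + 2) - P (k + 1) =
      t • (Submodule.span ℝ {P (k + 1)})ᗮ.reflection (P (k + 1) - P k)

/-- The open disc of radius `R` with the first `n` chords of the trajectory removed. -/
def cutDisc (R : ℝ) (P : ℕ → ℂ) (n : ℕ) : Set ℂ :=
  Metric.ball (0 : ℂ) R \ ⋃ k ∈ Finset.range n, segment ℝ (P k) (P (k + 1))

/-- The regions into which the first `n` chords cut the disc: the connected components of
the disc with these chords removed. -/
def regions (R : ℝ) (P : ℕ → ℂ) (n : ℕ) : Set (Set ℂ) :=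
  {U | ∃ x ∈ cutDisc R P n, U = connectedComponentIn (cutDisc R P n) x}

/-- The number of regions after `n` scatterings. -/
def numRegions (R : ℝ) (P : ℕ → ℂ) (n : ℕ) : ℕ :=
  (regions R P n).ncard

/-- The Kronecker delta. -/
def kronecker (i j : ℕ) : ℚ := if i = j then 1 else 0

end CircularBilliard

end

/-!
The chords are full chords of the circle, so inside the open disc each of them is the trace of a
line, and the regions are the cells of a line arrangement restricted to the disc. The cells are
convex, hence they correspond to the sign patterns that the affine equations of the lines realise
at points of the disc (`components_eq_image_signPatterns`).

The count is by deletion and restriction (`ncard_signPatterns_insert`): a further line divides in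
two exactly the cells that it meets, so it adds as many cells as the earlier lines cut out on it.
On an open interval cut by distinct points this number is one more than the number of points, which
is the same principle in dimension one (`ncard_signPatterns_Ioo`).

By the law of reflection the trajectory is the orbit of a rotation
(`IsTrajectory.eq_pow_mul`), so all chords have the same distance `d` from the centre. On a chord
with its signed coordinate `s` measured from the midpoint, the chord `i` steps earlier meets it at
`s = d * tan (r * π / (2 * p + 1))`, where `2 * r` is congruent to `i` modulo `2 * p + 1` and
`|r| ≤ p` (`affine_on_chord`). For `1 ≤ i ≤ 2 * p` these values are pairwise distinct since `tan` is
injective on `(-π/2, π/2)`, so no three chords are concurrent; and they are interior to the chord,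
that is `|r| < p`, unless `i = 1` or `i = 2 * p`, when the two chords share an endpoint
(`numRegions_succ`). Hence the `(n + 1)`-st chord has `n - 1` crossings with the earlier ones for
`1 ≤ n < 2 * p`, and one less for the chord that closes the polygon.
-/

namespace CircularBilliard

/-! ### Sign patterns of hyperplane arrangements -/

section SignPatterns

variable {ι E : Type*}

/-- The sign patterns realised on `C` by the functions `g j`, `j ∈ J`: a point of `C` at which
none of them vanishes is recorded by the set of those `j ∈ J` with `0 < g j x`. -/
def signPatterns (C : Set E) (g : ι → E → ℝ) (J : Finset ι) : Set (Finset ι) :=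
  (fun x => J.filter (fun j => 0 < g j x)) '' {x ∈ C | ∀ j ∈ J, g j x ≠ 0}

lemma signPatterns_finite (C : Set E) (g : ι → E → ℝ) (J : Finset ι) :
    (signPatterns C g J).Finite := by
  refine (J.powerset.finite_toSet).subset ?_
  rintro _ ⟨x, -, rfl⟩
  simp only [Finset.coe_powerset, Set.mem_preimage, Set.mem_powerset_iff, Finset.coe_subset]
  exact Finset.filter_subset _ _

lemma notMem_of_mem_signPatterns {C : Set E} {g : ι → E → ℝ} {J S : Finset ι} {k : ι}
    (hk : k ∉ J) (hS : S ∈ signPatterns C g J) : k ∉ S := by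
  obtain ⟨x, -, rfl⟩ := hS
  simp [hk]

lemma signPatterns_empty {C : Set E} (hC : C.Nonempty) (g : ι → E → ℝ) :
    signPatterns C g ∅ = {∅} := by
  obtain ⟨x, hx⟩ := hC
  ext S
  simp only [signPatterns, Finset.filter_empty, Set.mem_image, Set.mem_singleton_iff]
  exact ⟨fun ⟨_, _, h⟩ => h.symm, fun h => ⟨x, ⟨hx, by simp⟩, h.symm⟩⟩

lemma signPatterns_image {F : Type*} (φ : F → E) (C : Set F) (g : ι → E → ℝ) (J : Finset ι) :
    signPatterns (φ '' C) g J = signPatterns C (fun j s => g j (φ s)) J := by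
  ext S
  constructor
  · rintro ⟨_, ⟨⟨s, hs, rfl⟩, h⟩, rfl⟩
    exact ⟨s, ⟨hs, h⟩, rfl⟩
  · rintro ⟨s, ⟨hs, h⟩, rfl⟩
    exact ⟨φ s, ⟨⟨s, hs, rfl⟩, h⟩, rfl⟩

lemma signPatterns_congr {C : Set E} {g g' : ι → E → ℝ} {J : Finset ι}
    (h : ∀ j ∈ J, g j = g' j) : signPatterns C g J = signPatterns C g' J := by
  have key : ∀ x, J.filter (fun j => 0 < g j x) = J.filter (fun j => 0 < g' j x) :=
    fun x => Finset.filter_congr fun j hj => by rw [h j hj]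
  have hset : {x ∈ C | ∀ j ∈ J, g j x ≠ 0} = {x ∈ C | ∀ j ∈ J, g' j x ≠ 0} := by
    ext x
    refine and_congr_right fun _ => forall₂_congr fun j hj => by rw [h j hj]
  simp only [signPatterns, key, hset]

lemma signPatterns_insert [DecidableEq ι] (C : Set E) (g : ι → E → ℝ) (J : Finset ι) (k : ι) :
    signPatterns C g (insert k J) =
      signPatterns (C ∩ {x | g k x < 0}) g J ∪
        insert k '' signPatterns (C ∩ {x | 0 < g k x}) g J := by
  ext S
  constructor
  · rintro ⟨x, ⟨hxC, hx⟩, rfl⟩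
    have hxJ : ∀ j ∈ J, g j x ≠ 0 := fun j hj => hx j (Finset.mem_insert_of_mem hj)
    rcases lt_or_gt_of_ne (hx k (Finset.mem_insert_self k J)) with h | h
    · exact Or.inl ⟨x, ⟨⟨hxC, h⟩, hxJ⟩, by simp [Finset.filter_insert, h.not_gt]⟩
    · exact Or.inr ⟨_, ⟨x, ⟨⟨hxC, h⟩, hxJ⟩, rfl⟩, by simp [Finset.filter_insert, h]⟩
  · rintro (⟨x, ⟨⟨hxC, h⟩, hxJ⟩, rfl⟩ | ⟨_, ⟨x, ⟨⟨hxC, h⟩, hxJ⟩, rfl⟩, rfl⟩) <;>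
      simp only [Set.mem_ofPred_eq] at h
    · refine ⟨x, ⟨hxC, ?_⟩, by simp [Finset.filter_insert, h.not_gt]⟩
      simpa using ⟨h.ne, hxJ⟩
    · refine ⟨x, ⟨hxC, ?_⟩, by simp [Finset.filter_insert, h]⟩
      simpa using ⟨h.ne', hxJ⟩

variable [NormedAddCommGroup E] [NormedSpace ℝ E]

/-- For affine functions, a sign pattern is realised by a convex set of points. -/
lemma convex_signPattern {C : Set E} (hC : Convex ℝ C) (f : ι → E →L[ℝ] ℝ) (c : ι → ℝ)
    (J S : Finset ι) :
    Convex ℝ {x ∈ {x ∈ C | ∀ j ∈ J, f j x - c j ≠ 0} |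
      J.filter (fun j => 0 < f j x - c j) = S} := by
  classical
  have hset : {x ∈ {x ∈ C | ∀ j ∈ J, f j x - c j ≠ 0} |
      J.filter (fun j => 0 < f j x - c j) = S} =
      {x | S ⊆ J} ∩ (C ∩ ⋂ j ∈ J, {x | if j ∈ S then c j < f j x else f j x < c j}) := by
    ext x
    simp only [Set.mem_ofPred_eq, Set.mem_inter_iff, Set.mem_iInter]
    constructor
    · rintro ⟨⟨hx, h0⟩, rfl⟩
      refine ⟨Finset.filter_subset _ _, hx, fun j hj => ?_⟩
      have := h0 j hj
      split_ifs with h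
      · simp only [Finset.mem_filter] at h; linarith [h.2]
      · simp only [Finset.mem_filter, not_and, not_lt] at h
        exact sub_neg.1 (lt_of_le_of_ne (h hj) this)
    · rintro ⟨hS, hx, h⟩
      refine ⟨⟨hx, fun j hj => ?_⟩, ?_⟩
      · have := h j hj
        split_ifs at this
        · linarith
        · exact (sub_neg.2 this).ne
      · ext j
        simp only [Finset.mem_filter]
        constructor
        · rintro ⟨hj, hp⟩
          by_contra hn
          have := h j hj
          rw [if_neg hn] at this
          linarith
        · intro hj
          have := h j (hS hj)
          rw [if_pos hj] at this
          exact ⟨hS hj, by linarith⟩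
  rw [hset]
  refine Convex.inter (fun x hx y hy a b _ _ _ => hx) (hC.inter (convex_iInter₂ fun j _ => ?_))
  split_ifs
  · exact convex_halfSpace_gt (f j).isLinear _
  · exact convex_halfSpace_lt (f j).isLinear _

lemma eventually_signPattern_eq {X : Type*} [TopologicalSpace X] {C : Set X} (hC : IsOpen C) {g : ι → X → ℝ}
    (hg : ∀ j, Continuous (g j)) (J : Finset ι) {x : X} (hx : x ∈ C)
    (hxJ : ∀ j ∈ J, g j x ≠ 0) :
    ∀ᶠ y in nhds x, (y ∈ C ∧ ∀ j ∈ J, g j y ≠ 0) ∧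
      J.filter (fun j => 0 < g j y) = J.filter (fun j => 0 < g j x) := by
  have h : ∀ᶠ y in nhds x, ∀ j ∈ J, g j y ≠ 0 ∧ (0 < g j y ↔ 0 < g j x) := by
    rw [Filter.eventually_all_finset]
    intro j hj
    rcases lt_or_gt_of_ne (hxJ j hj) with h | h
    · filter_upwards [(hg j).continuousAt.eventually_lt continuousAt_const h] with y hy
      exact ⟨hy.ne, by simp [hy.not_gt, h.not_gt]⟩
    · filter_upwards [continuousAt_const.eventually_lt (hg j).continuousAt h] with y hy
      exact ⟨hy.ne', by simp [hy, h]⟩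
  filter_upwards [hC.mem_nhds hx, h] with y hyC hy
  exact ⟨⟨hyC, fun j hj => (hy j hj).1⟩, Finset.filter_congr fun j hj => (hy j hj).2⟩

/-- Deletion and restriction: a further hyperplane cuts in two exactly those cells of an
arrangement in an open convex set that it meets. -/
theorem ncard_signPatterns_insert [DecidableEq ι] {C : Set E} (hC : Convex ℝ C) (hCo : IsOpen C)
    (f : ι → E →L[ℝ] ℝ) (c : ι → ℝ) {J : Finset ι} {k : ι} (hk : k ∉ J) (hfk : f k ≠ 0) :
    (signPatterns C (fun j x => f j x - c j) (insert k J)).ncard =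
      (signPatterns C (fun j x => f j x - c j) J).ncard +
        (signPatterns (C ∩ {x | f k x - c k = 0}) (fun j x => f j x - c j) J).ncard := by
  set g : ι → E → ℝ := fun j x => f j x - c j with hg
  have hgc : ∀ j, Continuous (g j) := fun j => by fun_prop
  set A := signPatterns (C ∩ {x | g k x < 0}) g J with hA
  set B := signPatterns (C ∩ {x | 0 < g k x}) g J with hB
  have hAf : A.Finite := signPatterns_finite _ _ _
  have hBf : B.Finite := signPatterns_finite _ _ _
  -- a point on the hyperplane has points with the same pattern on either side of it
  have hside : ∀ x ∈ C, (∀ j ∈ J, g j x ≠ 0) → g k x = 0 →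
      J.filter (fun j => 0 < g j x) ∈ A ∩ B := by
    intro x hx hxJ hxk
    obtain ⟨v, hv⟩ : ∃ v, 0 < f k v := by
      obtain ⟨v, hv⟩ : ∃ v, f k v ≠ 0 := by
        by_contra! h
        exact hfk (ContinuousLinearMap.ext h)
      rcases lt_or_gt_of_ne hv with h | h
      · exact ⟨-v, by simpa using h⟩
      · exact ⟨v, h⟩
    have hev := eventually_signPattern_eq hCo hgc J hx hxJ
    have ht : Filter.Tendsto (fun t : ℝ => x + t • v) (nhds 0) (nhds x) := by
      have : Continuous (fun t : ℝ => x + t • v) := by fun_prop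
      simpa using this.tendsto 0
    have hgt : ∀ t : ℝ, g k (x + t • v) = t * f k v := by
      intro t
      have : f k x - c k = 0 := hxk
      simp only [hg, map_add, map_smul, smul_eq_mul]
      linarith
    constructor
    · obtain ⟨t, ⟨h1, h2⟩, h3⟩ := (((ht.eventually hev).filter_mono nhdsWithin_le_nhds).and
        (self_mem_nhdsWithin (a := (0 : ℝ)) (s := Set.Iio 0))).exists
      exact ⟨_, ⟨⟨h1.1, by
        simp only [Set.mem_ofPred_eq, hgt]
        exact mul_neg_of_neg_of_pos h3 hv⟩, h1.2⟩, h2⟩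
    · obtain ⟨t, ⟨h1, h2⟩, h3⟩ := (((ht.eventually hev).filter_mono nhdsWithin_le_nhds).and
        (self_mem_nhdsWithin (a := (0 : ℝ)) (s := Set.Ioi 0))).exists
      exact ⟨_, ⟨⟨h1.1, by
        simp only [Set.mem_ofPred_eq, hgt]
        exact mul_pos h3 hv⟩, h1.2⟩, h2⟩
  have hunion : signPatterns C g J = A ∪ B := by
    ext S
    constructor
    · rintro ⟨x, ⟨hxC, hxJ⟩, rfl⟩
      rcases lt_trichotomy (g k x) 0 with h | h | h
      · exact Or.inl ⟨x, ⟨⟨hxC, h⟩, hxJ⟩, rfl⟩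
      · exact Or.inl (hside x hxC hxJ h).1
      · exact Or.inr ⟨x, ⟨⟨hxC, h⟩, hxJ⟩, rfl⟩
    · rintro (⟨x, ⟨⟨hxC, h⟩, hxJ⟩, rfl⟩ | ⟨x, ⟨⟨hxC, h⟩, hxJ⟩, rfl⟩)
      · exact ⟨x, ⟨hxC, hxJ⟩, rfl⟩
      · exact ⟨x, ⟨hxC, hxJ⟩, rfl⟩
  have hinter : signPatterns (C ∩ {x | g k x = 0}) g J = A ∩ B := by
    ext S
    constructor
    · rintro ⟨x, ⟨⟨hxC, h⟩, hxJ⟩, rfl⟩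
      exact hside x hxC hxJ h
    · rintro ⟨⟨x, ⟨⟨hxC, hx⟩, hxJ⟩, rfl⟩, ⟨y, ⟨⟨hyC, hy⟩, hyJ⟩, hxy⟩⟩
      -- a cell is connected, so `g k` vanishes in it if it takes both signs there
      obtain ⟨z, ⟨⟨hzC, hzJ⟩, hz⟩, hzk⟩ :=
        (convex_signPattern hC f c J (J.filter fun j => 0 < g j x)).isPreconnected
          |>.intermediate_value (a := x) (b := y) ⟨⟨hxC, hxJ⟩, rfl⟩ ⟨⟨hyC, hyJ⟩, hxy⟩
          (hgc k).continuousOn ⟨le_of_lt hx, le_of_lt hy⟩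
      exact ⟨z, ⟨⟨hzC, hzk⟩, hzJ⟩, hz⟩
  change _ = _ + (signPatterns (C ∩ {x | g k x = 0}) g J).ncard
  rw [signPatterns_insert C g J k, hunion, hinter, Set.ncard_union_add_ncard_inter A B hAf hBf,
    Set.ncard_union_eq ?_ hAf (hBf.image _), Set.InjOn.ncard_image]
  · intro S hS T hT hST
    rw [← Finset.erase_insert (notMem_of_mem_signPatterns hk hS),
      ← Finset.erase_insert (notMem_of_mem_signPatterns hk hT)]
    exact congrArg (Finset.erase · k) hST
  · rw [Set.disjoint_left]
    rintro S hS ⟨T, -, rfl⟩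
    exact notMem_of_mem_signPatterns hk hS (Finset.mem_insert_self k T)

/-- Distinct points `a j` cut an open interval into one piece more than there are points
in the interval. -/
lemma ncard_signPatterns_Ioo [DecidableEq ι] {h : ℝ} (hh : 0 < h) (b a : ι → ℝ) (J : Finset ι)
    (hb : ∀ j ∈ J, b j ≠ 0) (ha : Set.InjOn a J) :
    (signPatterns (Set.Ioo (-h) h) (fun j s => b j * (s - a j)) J).ncard =
      1 + (J.filter fun j => |a j| < h).card := by
  have hlin : (fun j s => b j * (s - a j)) =
      fun j s => (b j • ContinuousLinearMap.id ℝ ℝ) s - b j * a j := by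
    ext j s
    simp [mul_sub]
  induction J using Finset.induction_on with
  | empty => rw [signPatterns_empty ⟨0, by simp [hh]⟩]; simp
  | insert k J hk ih =>
    have hbk := hb k (Finset.mem_insert_self k J)
    have hrest : Set.Ioo (-h) h ∩
        {x | (b k • ContinuousLinearMap.id ℝ ℝ) x - b k * a k = 0} =
        if |a k| < h then {a k} else ∅ := by
      ext s
      have : b k * s - b k * a k = 0 ↔ s = a k := by
        rw [← mul_sub, mul_eq_zero, or_iff_right hbk, sub_eq_zero]
      simp only [Set.mem_inter_iff, ← abs_lt, Set.mem_Ioo, Set.mem_ofPred_eq,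
        smul_apply, ContinuousLinearMap.id_apply, smul_eq_mul, this]
      split_ifs with hs
      · exact ⟨fun H => H.2, fun H => ⟨by rwa [H], H⟩⟩
      · exact ⟨fun H => absurd (H.2 ▸ H.1) hs, fun H => H.elim⟩
    have hcard : (signPatterns (if |a k| < h then {a k} else ∅)
        (fun j s => b j * (s - a j)) J).ncard = if |a k| < h then 1 else 0 := by
      split_ifs
      · rw [Set.ncard_eq_one]
        refine ⟨J.filter fun j => 0 < b j * (a k - a j), ?_⟩
        ext S
        constructor
        · rintro ⟨x, ⟨hx, -⟩, rfl⟩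
          rw [Set.mem_singleton_iff] at hx
          rw [hx]; rfl
        · rintro rfl
          refine ⟨a k, ⟨rfl, fun j hj => mul_ne_zero (hb j (Finset.mem_insert_of_mem hj)) ?_⟩, rfl⟩
          rw [sub_ne_zero]
          intro hkj
          have := ha (Finset.mem_insert_self k J) (Finset.mem_insert_of_mem hj) hkj
          exact hk (this ▸ hj)
      · simp [signPatterns]
    have hne : b k • ContinuousLinearMap.id ℝ ℝ ≠ 0 := by
      intro H
      have := congrArg (fun f : ℝ →L[ℝ] ℝ => f 1) H
      simp at this
      exact hbk this
    rw [hlin, ncard_signPatterns_insert (convex_Ioo _ _) isOpen_Ioo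
      (fun j => b j • ContinuousLinearMap.id ℝ ℝ) (fun j => b j * a j) hk hne, hrest, ← hlin,
      hcard, ih (fun j hj => hb j (Finset.mem_insert_of_mem hj))
        (ha.mono (by simp)), Finset.filter_insert]
    split_ifs
    · rw [Finset.card_insert_of_notMem (by simp [hk])]; ring
    · rfl

/-- The connected components of an open convex set minus finitely many hyperplanes are in
bijection with the sign patterns, because the points with a given pattern form a convex set. -/
theorem components_eq_image_signPatterns {C : Set E} (hC : Convex ℝ C)
    (f : ι → E →L[ℝ] ℝ) (c : ι → ℝ) (J : Finset ι) {D : Set E}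
    (hD : D = {x ∈ C | ∀ j ∈ J, f j x - c j ≠ 0}) :
    {U | ∃ x ∈ D, U = connectedComponentIn D x} =
      (fun S => {x ∈ D | J.filter (fun j => 0 < f j x - c j) = S}) ''
        signPatterns C (fun j x => f j x - c j) J := by
  have key : ∀ x ∈ D, connectedComponentIn D x =
      {y ∈ D | J.filter (fun j => 0 < f j y - c j) = J.filter (fun j => 0 < f j x - c j)} := by
    intro x hx
    apply Set.Subset.antisymm
    · intro y hy
      refine ⟨connectedComponentIn_subset D x hy, Finset.filter_congr fun j hj => ?_⟩
      have hpre := isPreconnected_connectedComponentIn (x := x) (F := D)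
      have hxm := mem_connectedComponentIn hx
      have hcont : ContinuousOn (fun z => f j z - c j) (connectedComponentIn D x) := by fun_prop
      have hnz : ∀ z ∈ connectedComponentIn D x, f j z - c j ≠ 0 := by
        intro z hz
        have := connectedComponentIn_subset D x hz
        rw [hD] at this
        exact this.2 j hj
      constructor
      · intro hpos
        by_contra hn
        obtain ⟨z, hz, hz0⟩ := hpre.intermediate_value hxm hy hcont ⟨not_lt.1 hn, hpos.le⟩
        exact hnz z hz hz0
      · intro hpos
        by_contra hn
        obtain ⟨z, hz, hz0⟩ := hpre.intermediate_value hy hxm hcont ⟨not_lt.1 hn, hpos.le⟩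
        exact hnz z hz hz0
    · refine IsPreconnected.subset_connectedComponentIn ?_ ⟨hx, rfl⟩ (fun y hy => hy.1)
      subst hD
      exact (convex_signPattern hC f c J _).isPreconnected
  ext U
  constructor
  · rintro ⟨x, hx, rfl⟩
    exact ⟨_, ⟨x, by rwa [hD] at hx, rfl⟩, (key x hx).symm⟩
  · rintro ⟨_, ⟨x, hx, rfl⟩, rfl⟩
    rw [← hD] at hx
    exact ⟨x, hx, (key x hx).symm⟩

lemma ncard_components {C : Set E} (hC : Convex ℝ C)
    (f : ι → E →L[ℝ] ℝ) (c : ι → ℝ) (J : Finset ι) {D : Set E}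
    (hD : D = {x ∈ C | ∀ j ∈ J, f j x - c j ≠ 0}) :
    {U | ∃ x ∈ D, U = connectedComponentIn D x}.ncard =
      (signPatterns C (fun j x => f j x - c j) J).ncard := by
  rw [components_eq_image_signPatterns hC f c J hD, Set.InjOn.ncard_image]
  rintro _ ⟨x, hx, rfl⟩ T - hST
  rw [← hD] at hx
  dsimp only at hST
  have hmem : x ∈ {y ∈ D | J.filter (fun j => 0 < f j y - c j) = T} := by
    have hx' : x ∈ {y ∈ D | J.filter (fun j => 0 < f j y - c j) =
      J.filter (fun j => 0 < f j x - c j)} := ⟨hx, rfl⟩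
    rwa [hST] at hx'
  exact hmem.2

end SignPatterns

/-! ### The trajectory as an orbit of a rotation -/

open Complex ComplexConjugate

/-- Elastic reflection preserves the angle between successive scattering points, so that the
trajectory is the orbit of a rotation. -/
lemma IsTrajectory.eq_pow_mul {R θ : ℝ} {P : ℕ → ℂ} (hP : IsTrajectory R θ P) (hR : 0 < R)
    (hθ : Real.cos θ < 1) (k : ℕ) : P k = exp (θ * I) ^ k * P 0 := by
  set w : ℂ := exp (θ * I) with hw
  have hwre : w.re = Real.cos θ := exp_ofReal_mul_I_re θ
  have hwim : w.im = Real.sin θ := exp_ofReal_mul_I_im θ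
  have hsc := Real.sin_sq_add_cos_sq θ
  have hww : conj w * w = 1 := by
    rw [← normSq_eq_conj_mul_self, normSq_apply, hwre, hwim]
    norm_cast
    linarith
  have step : ∀ k, P (k + 1) = w * P k := by
    intro k
    induction k with
    | zero => exact hP.first_angle
    | succ k ih =>
      obtain ⟨t, ht, h⟩ := hP.elastic k
      set u := P (k + 1) with hu
      have hun : ‖u‖ = R := hP.on_circle (k + 1)
      have hu2 : u.re ^ 2 + u.im ^ 2 = R ^ 2 := by
        rw [← hun, ← normSq_eq_norm_sq, normSq_apply]; ring
      have hPk : P k = conj w * u := by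
        rw [ih, ← mul_assoc, hww, one_mul]
      have hrefl : (Submodule.span ℝ {u})ᗮ.reflection (u - P k) = u * (w - 1) := by
        rw [Submodule.reflection_orthogonal_apply, Submodule.reflection_singleton_apply, hPk]
        have hin : inner ℝ u (u - conj w * u) / (((‖u‖ : ℝ) : ℝ) ^ 2) = 1 - Real.cos θ := by
          rw [hun, div_eq_iff (by positivity), Complex.inner]
          simp only [mul_re, mul_im, sub_re, sub_im, conj_re, conj_im, hwre, hwim]
          linear_combination (1 - Real.cos θ) * hu2
        have hcw : conj w = 2 * (Real.cos θ : ℂ) - w := by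
          apply Complex.ext
          · simp [-ofReal_cos, hwre]; ring
          · simp [-ofReal_cos]
        simp only [RCLike.ofReal_real_eq_id, id_eq] at hin ⊢
        rw [hin, real_smul, nsmul_eq_mul, hcw]
        push_cast
        ring
      rw [hrefl, real_smul] at h
      have hnext : P (k + 2) = u * (1 + t * (w - 1)) := by linear_combination h
      have hn1 : ‖1 + t * (w - 1)‖ = 1 := by
        have h2 := hP.on_circle (k + 2)
        rw [hnext, norm_mul, hun] at h2
        exact mul_left_cancel₀ hR.ne' (h2.trans (mul_one R).symm)
      have hn2 : (1 + t * (Real.cos θ - 1)) ^ 2 + (t * Real.sin θ) ^ 2 = 1 := by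
        have h3 : normSq (1 + t * (w - 1)) = 1 := by rw [normSq_eq_norm_sq, hn1, one_pow]
        rw [normSq_apply] at h3
        simp only [add_re, add_im, one_re, one_im, mul_re, mul_im, ofReal_re, ofReal_im, sub_re,
          sub_im, hwre, hwim] at h3
        linear_combination h3
      -- the line through `u` in the reflected direction meets the circle at `t = 0` and `t = 1`
      have ht1 : t = 1 := by
        have h4 : 2 * (1 - Real.cos θ) * t * (t - 1) = 0 := by
          linear_combination hn2 - t ^ 2 * hsc
        rcases mul_eq_zero.1 h4 with h5 | h5
        · exact absurd h5 (mul_ne_zero (by linarith) ht.ne')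
        · linarith
      rw [hnext, ht1]
      push_cast
      ring
  induction k with
  | zero => simp
  | succ k ih => rw [step, ih]; ring

/-! ### Chords of the disc -/

/-- The real linear functional `z ↦ re (conj m * z)`, the scalar product with `m`. -/
noncomputable def dotCLM (m : ℂ) : ℂ →L[ℝ] ℝ := reCLM ∘L ContinuousLinearMap.mul ℝ ℂ (conj m)

@[simp] lemma dotCLM_apply (m z : ℂ) : dotCLM m z = (conj m * z).re := rfl

/-- The open chord with unit normal `m`, half-length `h` and distance `d` from the centre,
parametrised by the signed distance from its midpoint. -/
lemma ball_inter_line_eq_image {R d h : ℝ} (hR : 0 < R) (hh : 0 < h)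
    (hdh : d ^ 2 + h ^ 2 = R ^ 2) {m : ℂ} (hm : ‖m‖ = 1) :
    Metric.ball (0 : ℂ) R ∩ {z | dotCLM m z - d = 0} =
      (fun s : ℝ => m * (d + s * I)) '' Set.Ioo (-h) h := by
  have hmm : conj m * m = 1 := by
    rw [← normSq_eq_conj_mul_self, normSq_eq_norm_sq, hm]; simp
  have hns : ∀ s : ℝ, ‖m * (d + s * I)‖ ^ 2 = d ^ 2 + s ^ 2 := by
    intro s
    rw [norm_mul, hm, one_mul, ← normSq_eq_norm_sq, normSq_add_mul_I]
  have hlt : ∀ s : ℝ, ‖m * (d + s * I)‖ < R ↔ s ∈ Set.Ioo (-h) h := by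
    intro s
    rw [Set.mem_Ioo, ← abs_lt, ← sq_lt_sq₀ (norm_nonneg _) hR.le, hns, ← hdh,
      add_lt_add_iff_left, sq_lt_sq, abs_of_pos hh]
  ext z
  constructor
  · rintro ⟨hz, hzd⟩
    have hzd' : (conj m * z).re = d := sub_eq_zero.1 hzd
    have hzm : z = m * (d + (conj m * z).im * I) := by
      rw [← hzd', re_add_im]
      linear_combination (-z) * hmm
    refine ⟨(conj m * z).im, ?_, hzm.symm⟩
    rw [← hlt, ← hzm]
    simpa using hz
  · rintro ⟨s, hs, rfl⟩
    refine ⟨by simpa using (hlt s).2 hs, ?_⟩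
    simp only [Set.mem_ofPred_eq, dotCLM_apply, ← mul_assoc, hmm]
    simp

lemma mem_segment_iff_of_mem_ball {R d h : ℝ} (hR : 0 < R) (hh : 0 < h)
    (hdh : d ^ 2 + h ^ 2 = R ^ 2) {m : ℂ} (hm : ‖m‖ = 1) {z : ℂ}
    (hz : z ∈ Metric.ball (0 : ℂ) R) :
    z ∈ segment ℝ (m * (d - h * I)) (m * (d + h * I)) ↔ dotCLM m z - d = 0 := by
  have hmm : conj m * m = 1 := by
    rw [← normSq_eq_conj_mul_self, normSq_eq_norm_sq, hm]; simp
  constructor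
  · rintro ⟨a, b, -, -, hab, rfl⟩
    rw [map_add, map_smul, map_smul]
    simp only [dotCLM_apply, ← mul_assoc, hmm]
    simp only [smul_eq_mul, one_mul, add_re, sub_re, ofReal_re, mul_re, I_re, I_im, ofReal_im]
    linear_combination d * hab
  · intro hzd
    obtain ⟨s, ⟨hs1, hs2⟩, rfl⟩ :=
      (ball_inter_line_eq_image hR hh hdh hm).subset ⟨hz, hzd⟩
    refine ⟨(h - s) / (2 * h), (h + s) / (2 * h), div_nonneg (by linarith) (by linarith),
      div_nonneg (by linarith) (by linarith), by field_simp; ring, ?_⟩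
    have hhc : (h : ℂ) ≠ 0 := ofReal_ne_zero.2 hh.ne'
    simp only [real_smul]
    push_cast
    field_simp
    ring

/-! ### Crossings on a chord -/

/-- The angle index of the crossing of two chords that are `i` steps apart: the half `r` of `i`
modulo `2 p + 1`, chosen between `-p` and `p`. -/
def crossIndex (p i : ℕ) : ℤ :=
  if i % 2 = 0 then (i : ℤ) / 2 else ((i : ℤ) - (2 * p + 1)) / 2

lemma exists_eq_two_mul_crossIndex_add (p i : ℕ) :
    ∃ e : ℤ, (i : ℤ) = 2 * crossIndex p i + e * (2 * p + 1) := by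
  unfold crossIndex
  split_ifs
  · exact ⟨0, by omega⟩
  · exact ⟨1, by omega⟩

lemma crossIndex_bounds {p i : ℕ} (h1 : 1 ≤ i) (h2 : i ≤ 2 * p) :
    -(p : ℤ) ≤ crossIndex p i ∧ crossIndex p i ≤ p ∧ crossIndex p i ≠ 0 := by
  unfold crossIndex
  split_ifs <;> omega

lemma crossIndex_injOn {p i j : ℕ} (hi : i ≤ 2 * p) (hi1 : 1 ≤ i) (hj1 : 1 ≤ j)
    (hj : j ≤ 2 * p) (h : crossIndex p i = crossIndex p j) : i = j := by
  unfold crossIndex at h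
  split_ifs at h <;> omega

lemma crossIndex_abs_lt_iff {p i : ℕ} (h1 : 1 ≤ i) (h2 : i ≤ 2 * p) :
    (-(p : ℤ) < crossIndex p i ∧ crossIndex p i < p) ↔ i ≠ 1 ∧ i ≠ 2 * p := by
  unfold crossIndex
  split_ifs <;> omega

lemma crossAngle_mem {p : ℕ} {r : ℤ} (h1 : -(p : ℤ) ≤ r) (h2 : r ≤ p) :
    (r : ℝ) * (Real.pi / (2 * p + 1)) ∈ Set.Ioo (-(Real.pi / 2)) (Real.pi / 2) := by
  have hπ := Real.pi_pos
  have h1' : -(p : ℝ) ≤ r := by exact_mod_cast h1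
  have h2' : (r : ℝ) ≤ p := by exact_mod_cast h2
  have hq : (0 : ℝ) < 2 * p + 1 := by positivity
  rw [← mul_div_assoc]
  constructor
  · rw [neg_lt, ← neg_div, div_lt_div_iff₀ hq two_pos]; nlinarith
  · rw [div_lt_div_iff₀ hq two_pos]; nlinarith

/-- In the coordinate `s` on a chord at distance `d` from the centre, the line of the chord that
is `i` steps away meets it at `s = d * tan (r * π / (2 * p + 1))`, where `r` is the
`crossIndex`. -/
lemma affine_on_chord (p i : ℕ) (hi1 : 1 ≤ i) (hi : i ≤ 2 * p) (d s : ℝ) :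
    let β : ℝ := crossIndex p i * (Real.pi / (2 * p + 1))
    (exp (((p : ℝ) / (2 * p + 1) * (2 * Real.pi) : ℝ) * I) ^ i * (d + s * I)).re - d =
      (2 * Real.sin β * Real.cos β) * (s - d * Real.tan β) := by
  intro β
  obtain ⟨e, he⟩ := exists_eq_two_mul_crossIndex_add p i
  obtain ⟨hr1, hr2, -⟩ := crossIndex_bounds hi1 hi
  have hcos : Real.cos β ≠ 0 := (Real.cos_pos_of_mem_Ioo (crossAngle_mem hr1 hr2)).ne'
  have he' : (i : ℝ) = 2 * crossIndex p i + e * (2 * p + 1) := by exact_mod_cast he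
  have hangle : (i : ℝ) * ((p : ℝ) / (2 * p + 1) * (2 * Real.pi)) =
      -(2 * β) + (crossIndex p i + e * p : ℤ) * (2 * Real.pi) := by
    have hq : (2 * p + 1 : ℝ) ≠ 0 := by positivity
    rw [he']
    simp only [β]
    push_cast
    field_simp
    ring
  have hexp : exp (((p : ℝ) / (2 * p + 1) * (2 * Real.pi) : ℝ) * I) ^ i =
      exp ((-(2 * β) + (crossIndex p i + e * p : ℤ) * (2 * Real.pi) : ℝ) * I) := by
    rw [← hangle, ← exp_nat_mul]
    push_cast
    ring_nf
  rw [hexp, mul_re, exp_ofReal_mul_I_re, exp_ofReal_mul_I_im, Real.cos_add_int_mul_two_pi,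
    Real.sin_add_int_mul_two_pi, Real.cos_neg, Real.sin_neg, Real.cos_two_mul, Real.sin_two_mul,
    Real.tan_eq_sin_div_cos]
  simp only [add_re, add_im, ofReal_re, ofReal_im, mul_re, mul_im, I_re, I_im]
  field_simp
  linear_combination (2 * d) * Real.sin_sq_add_cos_sq β

/-! ### Counting regions -/

lemma abs_mul_tan_lt_iff {d x y : ℝ} (hd : 0 < d) (hx : x ∈ Set.Ioo (-(Real.pi / 2)) (Real.pi / 2))
    (hy : y ∈ Set.Ioo (-(Real.pi / 2)) (Real.pi / 2)) :
    |d * Real.tan x| < d * Real.tan y ↔ -y < x ∧ x < y := by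
  have hy' : -y ∈ Set.Ioo (-(Real.pi / 2)) (Real.pi / 2) := ⟨by linarith [hy.2], by linarith [hy.1]⟩
  rw [abs_mul, abs_of_pos hd, mul_lt_mul_iff_right₀ hd, abs_lt, ← Real.tan_neg,
    Real.strictMonoOn_tan.lt_iff_lt hy' hx, Real.strictMonoOn_tan.lt_iff_lt hx hy]

lemma card_crossing_of_lt {p n : ℕ} (h1 : 1 ≤ n) (h2 : n < 2 * p) :
    ((Finset.range n).filter fun j => n - j ≠ 1 ∧ n - j ≠ 2 * p).card + 1 = n := by
  have : ((Finset.range n).filter fun j => n - j ≠ 1 ∧ n - j ≠ 2 * p) = Finset.range (n - 1) := by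
    ext j
    simp only [Finset.mem_filter, Finset.mem_range]
    omega
  rw [this, Finset.card_range]
  omega

lemma card_crossing_two_mul {p : ℕ} (hp : 1 ≤ p) :
    ((Finset.range (2 * p)).filter fun j => 2 * p - j ≠ 1 ∧ 2 * p - j ≠ 2 * p).card + 2 =
      2 * p := by
  have : ((Finset.range (2 * p)).filter fun j => 2 * p - j ≠ 1 ∧ 2 * p - j ≠ 2 * p) =
      Finset.Ico 1 (2 * p - 1) := by
    ext j
    simp only [Finset.mem_filter, Finset.mem_range, Finset.mem_Ico]
    omega
  rw [this, Nat.card_Ico]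
  omega

/-- Inside the open disc a chord coincides with its line, so the cut disc is a disc minus a
hyperplane arrangement. -/
lemma cutDisc_eq {R d h : ℝ} (hR : 0 < R) (hh : 0 < h) (hdh : d ^ 2 + h ^ 2 = R ^ 2)
    {m : ℕ → ℂ} (hm : ∀ k, ‖m k‖ = 1) {P : ℕ → ℂ}
    (h0 : ∀ k, P k = m k * (d - h * I)) (h1 : ∀ k, P (k + 1) = m k * (d + h * I)) (n : ℕ) :
    cutDisc R P n =
      {z ∈ Metric.ball (0 : ℂ) R | ∀ j ∈ Finset.range n, dotCLM (m j) z - d ≠ 0} := by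
  ext z
  simp only [cutDisc, Set.mem_sdiff, Set.mem_iUnion, not_exists, Set.mem_ofPred_eq]
  refine and_congr_right fun hz => forall₂_congr fun j _ => not_congr ?_
  rw [h0 j, h1 j]
  exact mem_segment_iff_of_mem_ball hR hh hdh (hm j) hz

/-- All chords of the trajectory have the same distance `d` from the centre and the same
half-length `h`; their unit normals `m k` are successive rotations by the angle of the
trajectory. -/
lemma IsTrajectory.exists_normals {p : ℕ} (hp : 1 ≤ p) {R : ℝ} (hR : 0 < R) {P : ℕ → ℂ}
    (hP : IsTrajectory R ((p : ℝ) / (2 * (p : ℝ) + 1) * (2 * Real.pi)) P) :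
    ∃ (d h : ℝ) (m : ℕ → ℂ), 0 < d ∧ 0 < h ∧ d ^ 2 + h ^ 2 = R ^ 2 ∧
      h = d * Real.tan (p * (Real.pi / (2 * p + 1))) ∧ (∀ k, ‖m k‖ = 1) ∧
      (∀ k, P k = m k * (d - h * I)) ∧ (∀ k, P (k + 1) = m k * (d + h * I)) ∧
      ∀ j i, conj (m j) * m (j + i) =
        exp (((p : ℝ) / (2 * p + 1) * (2 * Real.pi) : ℝ) * I) ^ i := by
  set θ : ℝ := (p : ℝ) / (2 * (p : ℝ) + 1) * (2 * Real.pi) with hθ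
  set α : ℝ := p * (Real.pi / (2 * p + 1)) with hα
  have hθα : θ = 2 * α := by rw [hθ, hα]; ring
  have hαpos : 0 < α := by
    have : (0 : ℝ) < p := by exact_mod_cast hp
    positivity
  have hαmem : α ∈ Set.Ioo (-(Real.pi / 2)) (Real.pi / 2) := by
    have := crossAngle_mem (p := p) (r := p) (by omega) le_rfl
    simpa using this
  have hcα : 0 < Real.cos α := Real.cos_pos_of_mem_Ioo hαmem
  have hsα : 0 < Real.sin α := Real.sin_pos_of_pos_of_lt_pi hαpos (by linarith [hαmem.2, Real.pi_pos])
  have hsc := Real.sin_sq_add_cos_sq α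
  have hcosθ : Real.cos θ < 1 := by
    rw [hθα, Real.cos_two_mul]; nlinarith
  have hrot := hP.eq_pow_mul hR hcosθ
  set w : ℂ := exp (θ * I) with hw
  set v : ℂ := exp (α * I) with hv
  have hwv : w = v * v := by
    rw [hw, hv, ← exp_add, hθα]; push_cast; ring_nf
  have hv1 : ‖v‖ = 1 := norm_exp_ofReal_mul_I α
  have hw1 : ‖w‖ = 1 := norm_exp_ofReal_mul_I θ
  have hconj : ∀ z : ℂ, ‖z‖ = 1 → conj z * z = 1 := by
    intro z hz
    rw [← normSq_eq_conj_mul_self, normSq_eq_norm_sq, hz]; simp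
  have hRc : (R : ℂ) ≠ 0 := ofReal_ne_zero.2 hR.ne'
  have hvc : v = Real.cos α + Real.sin α * I := by
    rw [hv, exp_mul_I, ofReal_cos, ofReal_sin]
  have hvc' : conj v = Real.cos α - Real.sin α * I := by
    rw [hvc, map_add, map_mul, conj_I, conj_ofReal, conj_ofReal]; ring
  have hm : ∀ k, ‖w ^ k * (v * (P 0 / R))‖ = 1 := by
    intro k
    rw [norm_mul, norm_pow, hw1, one_pow, norm_mul, hv1, norm_div, hP.on_circle, norm_real,
      Real.norm_of_nonneg hR.le, div_self hR.ne']
    norm_num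
  refine ⟨R * Real.cos α, R * Real.sin α, fun k => w ^ k * (v * (P 0 / R)), by positivity,
    by positivity, by linear_combination R ^ 2 * hsc, ?_, hm, ?_, ?_, ?_⟩
  · rw [Real.tan_eq_sin_div_cos]; field_simp
  · intro k
    have : ((R * Real.cos α : ℝ) : ℂ) - (R * Real.sin α : ℝ) * I = R * conj v := by
      rw [hvc']; push_cast; ring
    rw [this, hrot k]
    field_simp
    linear_combination (-w ^ k * P 0) * hconj v hv1
  · intro k
    have : ((R * Real.cos α : ℝ) : ℂ) + (R * Real.sin α : ℝ) * I = R * v := by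
      rw [hvc]; push_cast; ring
    rw [this, hrot (k + 1), pow_succ]
    field_simp
    rw [hwv]
    ring
  · intro j i
    have := hconj _ (hm j)
    calc conj (w ^ j * (v * (P 0 / R))) * (w ^ (j + i) * (v * (P 0 / R)))
        = (conj (w ^ j * (v * (P 0 / R))) * (w ^ j * (v * (P 0 / R)))) * w ^ i := by ring
      _ = w ^ i := by rw [this, one_mul]

lemma regions_finite {p : ℕ} (hp : 1 ≤ p) {R : ℝ} (hR : 0 < R) {P : ℕ → ℂ}
    (hP : IsTrajectory R ((p : ℝ) / (2 * (p : ℝ) + 1) * (2 * Real.pi)) P) (n : ℕ) :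
    (regions R P n).Finite := by
  obtain ⟨d, h, m, -, hh, hdh, -, hm, h0, h1, -⟩ := hP.exists_normals hp hR
  rw [regions, components_eq_image_signPatterns (convex_ball _ _) (fun j => dotCLM (m j))
    (fun _ => d) _ (cutDisc_eq hR hh hdh hm h0 h1 n)]
  exact (signPatterns_finite _ _ _).image _

lemma numRegions_zero {R : ℝ} (hR : 0 < R) (P : ℕ → ℂ) : numRegions R P 0 = 1 := by
  have hcut : cutDisc R P 0 =
      {x ∈ Metric.ball (0 : ℂ) R | ∀ j ∈ (∅ : Finset ℕ), (0 : ℂ →L[ℝ] ℝ) x - 0 ≠ 0} := by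
    ext x
    simp [cutDisc]
  rw [numRegions, regions, ncard_components (convex_ball _ _) (fun _ : ℕ => 0) (fun _ => 0) ∅ hcut,
    signPatterns_empty ⟨0, by simpa using hR⟩, Set.ncard_singleton]

/-- The new chord creates one region more than it has crossings with the earlier chords. It
crosses all of them except those with which it shares an endpoint on the circle, and the
crossings are distinct. -/
theorem numRegions_succ {p : ℕ} (hp : 1 ≤ p) {R : ℝ} (hR : 0 < R) {P : ℕ → ℂ}
    (hP : IsTrajectory R ((p : ℝ) / (2 * (p : ℝ) + 1) * (2 * Real.pi)) P) {n : ℕ}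
    (hn : n ≤ 2 * p) :
    numRegions R P (n + 1) = numRegions R P n +
      (1 + ((Finset.range n).filter fun j => n - j ≠ 1 ∧ n - j ≠ 2 * p).card) := by
  obtain ⟨d, h, m, hd, hh, hdh, htan, hm, h0, h1, hmm⟩ := hP.exists_normals hp hR
  have hcount : ∀ k, numRegions R P k =
      (signPatterns (Metric.ball (0 : ℂ) R) (fun j x => dotCLM (m j) x - d)
        (Finset.range k)).ncard := fun k =>
    ncard_components (convex_ball _ _) (fun j => dotCLM (m j)) (fun _ => d) _
      (cutDisc_eq hR hh hdh hm h0 h1 k)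
  have hne : dotCLM (m n) ≠ 0 := by
    intro H
    have : dotCLM (m n) (m n) = 0 := by rw [H]; rfl
    rw [dotCLM_apply, ← normSq_eq_conj_mul_self, ofReal_re, normSq_eq_norm_sq, hm] at this
    norm_num at this
  rw [hcount, hcount, Finset.range_add_one,
    ncard_signPatterns_insert (convex_ball _ _) Metric.isOpen_ball (fun j => dotCLM (m j))
      (fun _ => d) Finset.notMem_range_self hne, ball_inter_line_eq_image hR hh hdh (hm n),
    signPatterns_image]
  congr 1
  -- it remains to count the pieces of the new chord between its crossings with the earlier ones
  set β : ℕ → ℝ := fun j => crossIndex p (n - j) * (Real.pi / (2 * p + 1)) with hβ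
  have hδ : 0 < Real.pi / (2 * p + 1) := by positivity
  have hidx : ∀ j ∈ Finset.range n, 1 ≤ n - j ∧ n - j ≤ 2 * p := by
    intro j hj
    have := Finset.mem_range.1 hj
    omega
  have hβmem : ∀ j ∈ Finset.range n, β j ∈ Set.Ioo (-(Real.pi / 2)) (Real.pi / 2) := fun j hj =>
    let ⟨h1, h2, _⟩ := crossIndex_bounds (hidx j hj).1 (hidx j hj).2
    crossAngle_mem h1 h2
  have hβ0 : ∀ j ∈ Finset.range n, 2 * Real.sin (β j) * Real.cos (β j) ≠ 0 := by
    intro j hj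
    obtain ⟨hl, hr⟩ := hβmem j hj
    have hr0 := (crossIndex_bounds (hidx j hj).1 (hidx j hj).2).2.2
    have hβne : β j ≠ 0 := mul_ne_zero (Int.cast_ne_zero.2 hr0) hδ.ne'
    refine mul_ne_zero (mul_ne_zero two_ne_zero fun hs => hβne ?_)
      (Real.cos_pos_of_mem_Ioo (hβmem j hj)).ne'
    exact (Real.sin_eq_zero_iff_of_lt_of_lt (by linarith [Real.pi_pos])
      (by linarith [Real.pi_pos])).1 hs
  have hinj : Set.InjOn (fun j => d * Real.tan (β j)) (Finset.range n) := by
    intro i hi j hj hij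
    have h2 := Real.strictMonoOn_tan.injOn (hβmem i hi) (hβmem j hj)
      (mul_left_cancel₀ hd.ne' hij)
    have h3 : crossIndex p (n - i) = crossIndex p (n - j) := by
      exact_mod_cast mul_right_cancel₀ hδ.ne' h2
    have h4 := crossIndex_injOn (hidx i hi).2 (hidx i hi).1 (hidx j hj).1 (hidx j hj).2 h3
    have := Finset.mem_range.1 (Finset.mem_coe.1 hi)
    have := Finset.mem_range.1 (Finset.mem_coe.1 hj)
    omega
  rw [signPatterns_congr (g' := fun j s =>
    (2 * Real.sin (β j) * Real.cos (β j)) * (s - d * Real.tan (β j))) ?_,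
    ncard_signPatterns_Ioo hh _ _ _ hβ0 hinj]
  · congr 2
    refine Finset.filter_congr fun j hj => ?_
    have hαmem : (p : ℝ) * (Real.pi / (2 * p + 1)) ∈
        Set.Ioo (-(Real.pi / 2)) (Real.pi / 2) := by
      simpa using crossAngle_mem (p := p) (r := p) (by omega) le_rfl
    -- the endpoints of the new chord are the points with parameter `± h`, of index `± p`
    rw [htan, abs_mul_tan_lt_iff hd (hβmem j hj) hαmem,
      ← crossIndex_abs_lt_iff (hidx j hj).1 (hidx j hj).2, ← neg_mul,
      mul_lt_mul_iff_left₀ hδ, mul_lt_mul_iff_left₀ hδ]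
    norm_cast
  · intro j hj
    funext s
    have hjn : j + (n - j) = n := by have := Finset.mem_range.1 hj; omega
    have := hmm j (n - j)
    rw [hjn] at this
    rw [dotCLM_apply, ← mul_assoc, this]
    exact affine_on_chord p (n - j) (hidx j hj).1 (hidx j hj).2 d s

end CircularBilliard

open CircularBilliard

theorem mainTheorem1 (p : ℕ) (hp : 1 ≤ p) (R : ℝ) (hR : 0 < R) (P : ℕ → ℂ)
    (hP : CircularBilliard.IsTrajectory R ((p : ℝ) / (2 * (p : ℝ) + 1) * (2 * Real.pi)) P) :
    (∀ n : ℕ, n ≤ 2 * p + 1 →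
      (CircularBilliard.regions R P n).Finite ∧
      (CircularBilliard.numRegions R P n : ℚ) =
        2 - CircularBilliard.kronecker n 0 + ∑ i ∈ Finset.Ico 1 n, (i : ℚ)
          - CircularBilliard.kronecker (2 * p + 1) n ∧
      (CircularBilliard.numRegions R P n : ℚ) =
        2 - (CircularBilliard.kronecker n 0 + CircularBilliard.kronecker n (2 * p + 1))
          + (n : ℚ) * ((n : ℚ) - 1) / 2) ∧
    CircularBilliard.numRegions R P 0 = 1 ∧
    CircularBilliard.numRegions R P 1 = 2 ∧
    (∀ n : ℕ, 1 ≤ n → n < 2 * p →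
      CircularBilliard.numRegions R P (n + 1) = CircularBilliard.numRegions R P n + n) ∧
    CircularBilliard.numRegions R P (2 * p + 1) + 1 =
      CircularBilliard.numRegions R P (2 * p) + 2 * p ∧
    CircularBilliard.numRegions R P (2 * p + 1) = p * (2 * p + 1) + 1 := by
  have hf0 : numRegions R P 0 = 1 := numRegions_zero hR P
  have hf1 : numRegions R P 1 = 2 := by
    have := numRegions_succ hp hR hP (n := 0) (by omega)
    simpa [hf0] using this
  have hstep : ∀ n : ℕ, 1 ≤ n → n < 2 * p →
      numRegions R P (n + 1) = numRegions R P n + n := by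
    intro n h1 h2
    have := numRegions_succ hp hR hP h2.le
    have := card_crossing_of_lt h1 h2
    omega
  have hlast : numRegions R P (2 * p + 1) + 1 = numRegions R P (2 * p) + 2 * p := by
    have := numRegions_succ hp hR hP le_rfl
    have := card_crossing_two_mul hp
    omega
  have hmid : ∀ n : ℕ, 1 ≤ n → n ≤ 2 * p →
      (numRegions R P n : ℚ) = 2 + (n : ℚ) * ((n : ℚ) - 1) / 2 := by
    intro n h1
    induction n, h1 using Nat.le_induction with
    | base => intro _; rw [hf1]; norm_num
    | succ n h1 ih =>
      intro h2
      rw [hstep n h1 (by omega), Nat.cast_add, ih (by omega)]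
      push_cast
      ring
  have hend : (numRegions R P (2 * p + 1) : ℚ) = p * (2 * p + 1) + 1 := by
    have h1 := hmid (2 * p) (by omega) le_rfl
    have h2 : (numRegions R P (2 * p + 1) : ℚ) + 1 = numRegions R P (2 * p) + 2 * p := by
      exact_mod_cast hlast
    rw [h1] at h2
    push_cast at h2
    linear_combination h2
  have hsum : ∀ n : ℕ, ∑ i ∈ Finset.Ico 1 n, (i : ℚ) = (n : ℚ) * ((n : ℚ) - 1) / 2 := by
    intro n
    induction n with
    | zero => simp
    | succ n ih =>
      rcases Nat.eq_zero_or_pos n with rfl | hn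
      · simp
      · rw [Finset.sum_Ico_succ_top hn, ih]
        push_cast
        ring
  have hclosed : ∀ n : ℕ, n ≤ 2 * p + 1 → (numRegions R P n : ℚ) =
      2 - (kronecker n 0 + kronecker n (2 * p + 1)) + (n : ℚ) * ((n : ℚ) - 1) / 2 := by
    intro n hn
    rcases Nat.eq_zero_or_pos n with rfl | h1
    · rw [hf0]; norm_num [kronecker]
    · rcases hn.eq_or_lt with rfl | h2
      · rw [hend]
        simp only [kronecker, if_true, if_neg (Nat.succ_ne_zero (2 * p))]
        push_cast
        ring
      · rw [hmid n h1 (by omega)]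
        simp only [kronecker, if_neg h2.ne, if_neg (Nat.pos_iff_ne_zero.1 h1)]
        ring
  refine ⟨fun n hn => ⟨regions_finite hp hR hP n, ?_, hclosed n hn⟩, hf0, hf1, hstep, hlast,
    by exact_mod_cast hend⟩
  have hsymm : kronecker (2 * p + 1) n = kronecker n (2 * p + 1) := by
    simp only [kronecker, eq_comm]
  rw [hclosed n hn, hsum, hsymm]
  ring
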